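/- Let $X$ be a complex Banach space and let $L(X)$ be the algebra of bounded linear operators on $X$. For $A\in L(X)$ write $N(A)$ and $R(A)$ for its null-space and range. A subspace of $X$ is complemented if it is closed and has a closed algebraic complement in $X$. An operator $A\in L(X)$ is called - Riesz if, for every $\lambda\in\mathbb{C}\setminus\{0\}$, $\dim N(A-\lambda I)<\infty$ and $\operatorname{codim} R(A-\lambda I)<\infty$; - Saphar if $N(A)\subset R(A^n)$ for every $n\ge 1$, and $N(A)$ and $R(A)$ are complemented in $X$; - essentially Saphar if $N(A)\subset F+\bigcap_{n\ge 1}R(A^n)$ for some finite-dimensional subspace $F$ of $X$, and $N(A)$ and $R(A)$ are complemented in $X$. We write $(M,N)\in \mathrm{Red}(A)$ if $M$ and $N$ are closed $A$-invariant subspaces with $X=M\oplus N$; then $A_M$ and $A_N$ denote the restrictions of $A$ to operators $M\to M$ and $N\to N$. The operator $A$ is of Saphar type if there is $(M,N)\in\mathrm{Red}(A)$ such that $A_M$ is Saphar and $A_N$ is nilpotent, and $A$ admits a generalized Saphar–Riesz decomposition if there is $(M,N)\in\mathrm{Red}(A)$ such that $A_M$ is Saphar and $A_N$ is Riesz. (Here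 $M$ and $N$ may be finite-dimensional or zero.) Theorem. For every $A\in L(X)$ the following conditions are equivalent: (i) $A$ admits a generalized Saphar–Riesz decomposition; (ii) there exists a projector $P=P^2\in L(X)$ commuting with $A$ such that $A+P$ is essentially Saphar and $AP$ is Riesz; (iii) there exists a projector $P=P^2\in L(X)$ commuting with $A$ such that $A+P$ is of Saphar type and $AP$ is Riesz. -/

import Mathlib

namespace SapharRiesz

variable {X : Type*} [NormedAddCommGroup X] [NormedSpace ℂ X]

/-- The null-space of a bounded operator. -/
def nullSpace (A : X →L[ℂ] X) : Submodule ℂ X := LinearMap.ker (A : X →ₗ[ℂ] X)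

/-- The range of a bounded operator. -/
def rangeSpace (A : X →L[ℂ] X) : Submodule ℂ X := LinearMap.range (A : X →ₗ[ℂ] X)

/-- A subspace is complemented if it is closed and has a closed algebraic complement. -/
def IsComplemented (M : Submodule ℂ X) : Prop :=
  IsClosed (M : Set X) ∧ ∃ N : Submodule ℂ X, IsClosed (N : Set X) ∧ IsCompl M N

/-- Essential inclusion of subspaces: `M ⊆ L + F` for some finite-dimensional `F`. -/
def EssentiallyLE (M L : Submodule ℂ X) : Prop :=
  ∃ F : Submodule ℂ X, FiniteDimensional ℂ F ∧ M ≤ L ⊔ F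

/-- `A` is Riesz: `A - lam I` has finite-dimensional null-space and a range of finite codimension,
for every nonzero complex number `lam`. -/
def IsRiesz (A : X →L[ℂ] X) : Prop :=
  ∀ lam : ℂ, lam ≠ 0 →
    FiniteDimensional ℂ (nullSpace (A - lam • (1 : X →L[ℂ] X))) ∧
    FiniteDimensional ℂ (X ⧸ rangeSpace (A - lam • (1 : X →L[ℂ] X)))

/-- `A` is Kato: its range is closed and its null-space lies in the range of every power. -/
def IsKato (A : X →L[ℂ] X) : Prop :=
  IsClosed (rangeSpace A : Set X) ∧ ∀ n : ℕ, 1 ≤ n → nullSpace A ≤ rangeSpace (A ^ n)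

/-- `A` is Saphar: Kato, with complemented null-space and complemented range. -/
def IsSaphar (A : X →L[ℂ] X) : Prop :=
  IsKato A ∧ IsComplemented (nullSpace A) ∧ IsComplemented (rangeSpace A)

/-- `A` is essentially Saphar: the null-space is essentially contained in the intersection of the
ranges of all powers, and null-space and range are complemented. -/
def IsEssentiallySaphar (A : X →L[ℂ] X) : Prop :=
  EssentiallyLE (nullSpace A) (⨅ n : ℕ, ⨅ _ : 1 ≤ n, rangeSpace (A ^ n)) ∧
    IsComplemented (nullSpace A) ∧ IsComplemented (rangeSpace A)

/-- `(M, N) ∈ Red(A)`: closed `A`-invariant subspaces with `X = M ⊕ N`. -/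
structure Red (A : X →L[ℂ] X) (M N : Submodule ℂ X) : Prop where
  isClosed_left : IsClosed (M : Set X)
  isClosed_right : IsClosed (N : Set X)
  isCompl : IsCompl M N
  invariant_left : ∀ x ∈ M, A x ∈ M
  invariant_right : ∀ x ∈ N, A x ∈ N

/-- `A` is of Saphar type of degree `d`: it is the direct sum of a Saphar operator and a nilpotent
operator whose degree (least `k ≥ 0` with `k`-th power zero) is `d`. -/
def IsOfSapharTypeOfDegree (A : X →L[ℂ] X) (d : ℕ) : Prop :=
  ∃ (M N : Submodule ℂ X) (h : Red A M N),
    IsSaphar (A.restrict h.invariant_left) ∧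
    IsLeast {k : ℕ | (A.restrict h.invariant_right) ^ k = 0} d

/-- `A` is of Saphar type (of some degree). -/
def IsOfSapharType (A : X →L[ℂ] X) : Prop := ∃ d : ℕ, IsOfSapharTypeOfDegree A d

/-- `A` admits a generalized Saphar-Riesz decomposition. -/
def AdmitsGSRD (A : X →L[ℂ] X) : Prop :=
  ∃ (M N : Submodule ℂ X) (h : Red A M N),
    IsSaphar (A.restrict h.invariant_left) ∧ IsRiesz (A.restrict h.invariant_right)

end SapharRiesz

namespace SapharRiesz

variable {X : Type*} [NormedAddCommGroup X] [NormedSpace ℂ X]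

/-! The implications (ii) → (iii) → (i) rest on a decomposition built from two projections. Suppose
`N(T) ∩ R(T ^ d)` lies in every `R(T ^ n)`, `p` projects onto it, and `e` projects along `R(T) + N(T
^ d)`; this is `KatoData`. Then `M = R(e) + T R(e) + ⋯ + R(T ^ d)` and `N = {x ∈ N(T ^ d) : p T ^ i
x = 0 for all i}` reduce `T`, with `T_M` Saphar and `T_N` nilpotent (`KatoData.red`,
`KatoData.isSaphar_restrict`).

(i) → (ii): with `P` the projector onto `N` along `M`, `A + P` is `A_M ⊕ (A_N + I)`, and the Riesz
property at `-1` makes the second summand a finite-dimensional perturbation of the Saphar picture.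

(ii) → (iii): an essentially Saphar operator has Kato data, since the obstructions are
finite-dimensional.

(iii) → (i): a decomposition of `A + P` need not be compatible with `P`, but Kato data can be
compressed by `Q = I - P` (`KatoData.compress`). The resulting decomposition of `B = (A + P) Q = A
Q` has `M ⊆ R(Q)` and `R(P) ⊆ N`. Hence `A = B` on `M`, while on `N` the operator `A` is the
nilpotent `B_N` plus the Riesz restriction of `A P`; since `B A P = 0`, this sum is Riesz. -/

lemma mem_nullSpace {A : X →L[ℂ] X} {x : X} : x ∈ nullSpace A ↔ A x = 0 := Iff.rfl

lemma pow_add_apply (T : X →L[ℂ] X) (m n : ℕ) (x : X) :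
    (T ^ (m + n)) x = (T ^ m) ((T ^ n) x) := by
  rw [pow_add]; rfl

lemma pow_succ_apply (T : X →L[ℂ] X) (n : ℕ) (x : X) : (T ^ (n + 1)) x = (T ^ n) (T x) := by
  rw [pow_succ]; rfl

lemma pow_succ_apply' (T : X →L[ℂ] X) (n : ℕ) (x : X) : (T ^ (n + 1)) x = T ((T ^ n) x) := by
  rw [pow_succ']; rfl

lemma pow_apply_eq_zero_of_le {T : X →L[ℂ] X} {m n : ℕ} (h : m ≤ n) {x : X}
    (hx : (T ^ m) x = 0) : (T ^ n) x = 0 := by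
  obtain ⟨k, rfl⟩ := Nat.exists_eq_add_of_le' h
  rw [pow_add_apply, hx, map_zero]

lemma coe_restrict_pow_apply {A : X →L[ℂ] X} {M : Submodule ℂ X} (h : ∀ x ∈ M, A x ∈ M) (n : ℕ)
    (x : M) : (((A.restrict h) ^ n) x : X) = (A ^ n) (x : X) := by
  induction n generalizing x with
  | zero => rfl
  | succ n ih => rw [pow_succ_apply, pow_succ_apply, ih]; rfl

/-! ### Complemented subspaces and closed operator ranges -/

/-- `f` is a continuous projection onto the subspace `K`. -/
structure IsProjOnto (f : X →L[ℂ] X) (K : Submodule ℂ X) : Prop where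
  mem : ∀ x, f x ∈ K
  eq_self : ∀ x ∈ K, f x = x

lemma IsProjOnto.isComplemented {f : X →L[ℂ] X} {K : Submodule ℂ X} (h : IsProjOnto f K) :
    IsComplemented K := by
  have hc : K.ClosedComplemented := ⟨f.codRestrict K h.mem, fun x => Subtype.ext (h.eq_self x x.2)⟩
  exact ⟨hc.isClosed, hc.exists_isClosed_isCompl⟩

lemma IsComplemented.exists_proj [CompleteSpace X] {K : Submodule ℂ X} (h : IsComplemented K) :
    ∃ f : X →L[ℂ] X, IsProjOnto f K := by
  obtain ⟨f, hf⟩ := Submodule.closedComplemented_iff_isClosed_exists_isClosed_isCompl.2 h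
  exact ⟨K.subtypeL ∘L f, fun x => (f x).2, fun x hx => congrArg Subtype.val (hf ⟨x, hx⟩)⟩

lemma isComplemented_of_finiteDimensional (K : Submodule ℂ X) [FiniteDimensional ℂ K] :
    IsComplemented K := by
  have hc : K.ClosedComplemented := .of_finiteDimensional K
  exact ⟨hc.isClosed, hc.exists_isClosed_isCompl⟩

/-- Continuous projections adapted to a decomposition `X = M ⊕ N`. -/
lemma Red.exists_proj [CompleteSpace X] {A : X →L[ℂ] X} {M N : Submodule ℂ X} (h : Red A M N) :
    ∃ (f : X →L[ℂ] M) (g : X →L[ℂ] N), (∀ x : M, f x = x) ∧ (∀ x : N, g x = x) ∧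
      (∀ x : N, f x = 0) ∧ (∀ x : M, g x = 0) ∧ ∀ x, (f x : X) + g x = x := by
  have ht := Submodule.IsCompl.isTopCompl_of_isClosed h.isCompl h.isClosed_left h.isClosed_right
  refine ⟨M.projectionOntoL N ht, N.projectionOntoL M ht.symm, fun x => ?_, fun x => ?_,
    fun x => ?_, fun x => ?_, fun x => ?_⟩
  · simp
  · simp
  · simp
  · simp
  · simpa using Submodule.projection_add_projection_eq_self h.isCompl x

/-- An operator range with a closed algebraic complement is closed. -/
lemma isClosed_range_of_isCompl [CompleteSpace X] {E : Type*} [NormedAddCommGroup E]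
    [NormedSpace ℂ E] [CompleteSpace E] (S : E →L[ℂ] X) {N : Submodule ℂ X}
    (hN : IsClosed (N : Set X)) (h : IsCompl (LinearMap.range (S : E →ₗ[ℂ] X)) N) :
    IsClosed (LinearMap.range (S : E →ₗ[ℂ] X) : Set X) := by
  have := hN.completeSpace_coe
  -- By the open mapping theorem this surjection is a quotient map, so closedness can be tested on
  -- the preimage, which is `E × 0` even when `S` is not injective.
  let ψ : (E × N) →L[ℂ] X := S.coprod N.subtypeL
  have hψ : Function.Surjective ψ := by
    intro x
    have hx : x ∈ LinearMap.range (S : E →ₗ[ℂ] X) ⊔ N := by rw [h.sup_eq_top]; trivial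
    obtain ⟨_, ⟨u, rfl⟩, n, hn, rfl⟩ := Submodule.mem_sup.1 hx
    exact ⟨(u, ⟨n, hn⟩), by simp [ψ]⟩
  have hq : Topology.IsQuotientMap ψ := (ψ.isOpenMap hψ).isQuotientMap ψ.continuous hψ
  rw [← hq.isClosed_preimage]
  have : ψ ⁻¹' (LinearMap.range (S : E →ₗ[ℂ] X) : Set X) = {z | z.2 = 0} := by
    ext ⟨u, n⟩
    simp only [Set.mem_preimage, SetLike.mem_coe, Set.mem_ofPred_eq, ψ]
    constructor
    · rintro ⟨v, hv⟩
      have h1 : (n : X) ∈ LinearMap.range (S : E →ₗ[ℂ] X) := by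
        refine ⟨v - u, ?_⟩
        have hv' : S v = S u + n := by simpa using hv
        simp [hv']
      have h2 := Submodule.disjoint_def.1 h.disjoint _ h1 n.2
      exact Subtype.ext h2
    · rintro rfl
      exact ⟨u, by simp⟩
  rw [this]
  exact isClosed_singleton.preimage continuous_snd

lemma isComplemented_range_of_finite_quotient [CompleteSpace X] (S : X →L[ℂ] X)
    (h : FiniteDimensional ℂ (X ⧸ rangeSpace S)) : IsComplemented (rangeSpace S) := by
  obtain ⟨C, hC⟩ := (rangeSpace S).exists_isCompl
  have : FiniteDimensional ℂ C :=
    LinearEquiv.finiteDimensional ((rangeSpace S).quotientEquivOfIsCompl C hC)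
  exact ⟨isClosed_range_of_isCompl S C.closed_of_finiteDimensional hC, C,
    C.closed_of_finiteDimensional, hC⟩

/-! ### Kato data and the Kato decomposition -/

/-- The data from which a Kato decomposition of `T` is built: a projection `p` onto
`N(T) ∩ R(T ^ d)`, which lies in the range of every power of `T`, and an operator `e` that is a
projection along `R(T) + N(T ^ d)`. -/
structure KatoData (T : X →L[ℂ] X) (d : ℕ) (p e : X →L[ℂ] X) : Prop where
  le : ∀ x, T x = 0 → x ∈ rangeSpace (T ^ d) → ∀ n, x ∈ rangeSpace (T ^ n)
  p_ker : ∀ x, T (p x) = 0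
  p_range : ∀ x, p x ∈ rangeSpace (T ^ d)
  p_id : ∀ x, T x = 0 → x ∈ rangeSpace (T ^ d) → p x = x
  e_comp : ∀ x, e (T x) = 0
  e_ker : ∀ x, (T ^ d) x = 0 → e x = 0
  e_sub : ∀ x, ∃ y z, (T ^ d) z = 0 ∧ x = e x + T y + z

/-- If `N(T) ∩ R(T ^ d)` lies in the range of every power of `T`, then the null-space of every
power of `T` lies in `R(T) + N(T ^ d)`. -/
lemma nullSpace_pow_le {T : X →L[ℂ] X} {d : ℕ}
    (h : ∀ x, T x = 0 → x ∈ rangeSpace (T ^ d) → ∀ n, x ∈ rangeSpace (T ^ n)) (n : ℕ) :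
    nullSpace (T ^ n) ≤ rangeSpace T ⊔ nullSpace (T ^ d) := by
  induction n with
  | zero =>
    intro x hx
    have hx' : x = 0 := hx
    rw [hx']; exact zero_mem _
  | succ m ih =>
    intro x hx
    rw [mem_nullSpace] at hx
    rcases le_or_gt (m + 1) d with hd | hd
    · exact Submodule.mem_sup_right (pow_apply_eq_zero_of_le hd hx)
    · obtain ⟨k, rfl⟩ := Nat.exists_eq_add_of_le (Nat.lt_succ_iff.1 hd)
      -- `T ^ (d + k) x` lies in `N(T) ∩ R(T ^ d)`, so it equals `T ^ (d + k + 1) y`; subtracting `T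
      -- y` from `x` lowers the exponent by one.
      obtain ⟨y, hy⟩ := h ((T ^ (d + k)) x) (by rw [← pow_succ_apply', hx])
        ⟨(T ^ k) x, (pow_add_apply _ _ _ _).symm⟩ (d + k + 1)
      have h1 : x - T y ∈ nullSpace (T ^ (d + k)) := by
        have hy' : (T ^ (d + k + 1)) y = (T ^ (d + k)) x := hy
        rw [mem_nullSpace, map_sub, ← pow_succ_apply, hy', sub_self]
      have h2 := add_mem (ih h1) (Submodule.mem_sup_left (T := nullSpace (T ^ d))
        (show T y ∈ rangeSpace T from ⟨y, rfl⟩))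
      simpa using h2

/-- The regular part of a Kato decomposition:
`regPart T e k = R(e) + T R(e) + ⋯ + T ^ (k - 1) R(e) + R(T ^ k)`. -/
def regPart (T e : X →L[ℂ] X) : ℕ → Submodule ℂ X
  | 0 => ⊤
  | k + 1 => rangeSpace e ⊔ (regPart T e k).map (T : X →ₗ[ℂ] X)

lemma mem_regPart_succ {T e : X →L[ℂ] X} {k : ℕ} {x : X} :
    x ∈ regPart T e (k + 1) ↔ ∃ y, ∃ v ∈ regPart T e k, e y + T v = x := by
  simp only [regPart, Submodule.mem_sup, Submodule.mem_map]
  constructor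
  · rintro ⟨_, ⟨y, rfl⟩, _, ⟨v, hv, rfl⟩, rfl⟩
    exact ⟨y, v, hv, rfl⟩
  · rintro ⟨y, v, hv, rfl⟩
    exact ⟨_, ⟨y, rfl⟩, _, ⟨v, hv, rfl⟩, rfl⟩

lemma regPart_succ_le (T e : X →L[ℂ] X) (k : ℕ) : regPart T e (k + 1) ≤ regPart T e k := by
  induction k with
  | zero => exact le_top
  | succ k ih => exact sup_le_sup_left (Submodule.map_mono ih) _

lemma map_mem_regPart {T e : X →L[ℂ] X} {k : ℕ} {x : X} (hx : x ∈ regPart T e k) :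
    T x ∈ regPart T e k :=
  regPart_succ_le T e k (mem_regPart_succ.2 ⟨0, x, hx, by simp⟩)

lemma apply_mem_regPart (T e : X →L[ℂ] X) (k : ℕ) (x : X) : e x ∈ regPart T e k :=
  regPart_succ_le T e k (mem_regPart_succ.2 ⟨x, 0, zero_mem _, by simp⟩)

lemma pow_apply_mem_regPart (T e : X →L[ℂ] X) (k : ℕ) (x : X) : (T ^ k) x ∈ regPart T e k := by
  induction k with
  | zero => trivial
  | succ k ih => exact mem_regPart_succ.2 ⟨0, _, ih, by rw [map_zero, zero_add, pow_succ_apply']⟩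

/-- A sum of operator ranges is the range of one operator on a finite power of `X`, which brings
`regPart` within reach of `isClosed_range_of_isCompl`. -/
lemma exists_regPart_eq_range (T e : X →L[ℂ] X) (k : ℕ) :
    ∃ (n : ℕ) (S : (Fin n → X) →L[ℂ] X),
      regPart T e k = LinearMap.range (S : (Fin n → X) →ₗ[ℂ] X) := by
  induction k with
  | zero =>
    refine ⟨1, ContinuousLinearMap.proj 0, ?_⟩
    ext x
    exact ⟨fun _ => ⟨fun _ => x, rfl⟩, fun _ => trivial⟩
  | succ k ih =>
    obtain ⟨n, S, hS⟩ := ih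
    refine ⟨n + 1, e ∘L ContinuousLinearMap.proj 0 +
      T ∘L S ∘L ContinuousLinearMap.pi (fun i => ContinuousLinearMap.proj i.succ), ?_⟩
    ext x
    rw [mem_regPart_succ, hS]
    constructor
    · rintro ⟨y, _, ⟨f, rfl⟩, rfl⟩
      exact ⟨Fin.cons y f, rfl⟩
    · rintro ⟨f, rfl⟩
      exact ⟨f 0, _, ⟨fun i => f i.succ, rfl⟩, rfl⟩

/-- The nilpotent part of a Kato decomposition. -/
def nilPart (T : X →L[ℂ] X) (d : ℕ) (p : X →L[ℂ] X) : Submodule ℂ X :=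
  nullSpace (T ^ d) ⊓ ⨅ i : ℕ, nullSpace (p * T ^ i)

lemma mem_nilPart {T : X →L[ℂ] X} {d : ℕ} {p : X →L[ℂ] X} {x : X} :
    x ∈ nilPart T d p ↔ (T ^ d) x = 0 ∧ ∀ i : ℕ, p ((T ^ i) x) = 0 := by
  simp [nilPart, mem_nullSpace]

lemma isClosed_nilPart (T : X →L[ℂ] X) (d : ℕ) (p : X →L[ℂ] X) :
    IsClosed (nilPart T d p : Set X) := by
  have : (nilPart T d p : Set X) = {x | (T ^ d) x = 0} ∩ ⋂ i : ℕ, {x | p ((T ^ i) x) = 0} := by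
    ext x; simp [mem_nilPart]
  rw [this]
  exact (isClosed_eq (T ^ d).continuous continuous_const).inter (isClosed_iInter fun i =>
    isClosed_eq (p.continuous.comp (T ^ i).continuous) continuous_const)

lemma map_mem_nilPart {T : X →L[ℂ] X} {d : ℕ} {p : X →L[ℂ] X} {x : X}
    (hx : x ∈ nilPart T d p) : T x ∈ nilPart T d p := by
  rw [mem_nilPart] at hx ⊢
  refine ⟨?_, fun i => ?_⟩
  · rw [← pow_succ_apply, pow_succ_apply', hx.1, map_zero]
  · rw [← pow_succ_apply]; exact hx.2 _

namespace KatoData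

variable {T : X →L[ℂ] X} {d : ℕ} {p e : X →L[ℂ] X}

lemma e_pow_ker (h : KatoData T d p e) {n : ℕ} {x : X} (hx : (T ^ n) x = 0) : e x = 0 := by
  obtain ⟨_, ⟨y, rfl⟩, z, hz, rfl⟩ := Submodule.mem_sup.1 (nullSpace_pow_le h.le n hx)
  have h1 : e (T y) = 0 := h.e_comp y
  have h2 : e z = 0 := h.e_ker z hz
  exact (map_add e _ _).trans (by rw [h2, add_zero]; exact h1)

lemma e_idem (h : KatoData T d p e) (x : X) : e (e x) = e x := by
  obtain ⟨y, z, hz, hx⟩ := h.e_sub x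
  have := congrArg e hx
  rw [map_add, map_add, h.e_comp, h.e_ker z hz, add_zero, add_zero] at this
  exact this.symm

lemma regPart_sup (h : KatoData T d p e) (k : ℕ) : regPart T e k ⊔ nullSpace (T ^ d) = ⊤ := by
  induction k with
  | zero => simp [regPart]
  | succ k ih =>
    rw [eq_top_iff]
    intro x _
    obtain ⟨y, z, hz, hx⟩ := h.e_sub x
    have hy : y ∈ regPart T e k ⊔ nullSpace (T ^ d) := ih ▸ Submodule.mem_top
    obtain ⟨v, hv, w, hw, rfl⟩ := Submodule.mem_sup.1 hy
    refine Submodule.mem_sup.2 ⟨e x + T v, mem_regPart_succ.2 ⟨x, v, hv, rfl⟩, T w + z, ?_, ?_⟩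
    · rw [mem_nullSpace] at hw ⊢
      rw [map_add, hz, add_zero, ← pow_succ_apply, pow_succ_apply', hw, map_zero]
    · conv_rhs => rw [hx]
      rw [map_add]; abel

/-- Write `x = e y + T v`. Since `e` kills the null-space of every power of `T`, `0 = e x = e y`, so
`x = T v` with `v` one level down and killed by `T ^ (n + 1)`. -/
lemma exists_pow_eq (h : KatoData T d p e) {k n : ℕ} {x : X} (hx : x ∈ regPart T e k)
    (hn : (T ^ n) x = 0) : ∃ y, (T ^ k) y = x := by
  induction k generalizing n x with
  | zero => exact ⟨x, rfl⟩
  | succ k ih =>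
    obtain ⟨y, v, hv, rfl⟩ := mem_regPart_succ.1 hx
    have h1 := h.e_pow_ker hn
    rw [map_add, h.e_comp, add_zero, h.e_idem] at h1
    rw [h1, zero_add] at hn ⊢
    rw [← pow_succ_apply] at hn
    obtain ⟨w, rfl⟩ := ih hv hn
    exact ⟨w, pow_succ_apply' _ _ _⟩

/-- Each element of level `k` differs from one of level `k + 1` by some `T ^ k z` with `z ∈ N(T ^
d)`, and this error vanishes at `k = d`. Hence `M = R(e) + T M`, which identifies the range of
`T_M`. -/
lemma regPart_le_succ (h : KatoData T d p e) : regPart T e d ≤ regPart T e (d + 1) := by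
  have key : ∀ k, ∀ x ∈ regPart T e k, ∃ v ∈ regPart T e (k + 1), ∃ z, (T ^ d) z = 0 ∧
      x = v + (T ^ k) z := by
    intro k
    induction k with
    | zero =>
      intro x _
      obtain ⟨y, z, hz, hx⟩ := h.e_sub x
      exact ⟨_, mem_regPart_succ.2 ⟨x, y, trivial, rfl⟩, z, hz, hx⟩
    | succ k ih =>
      intro x hx
      obtain ⟨y, v, hv, rfl⟩ := mem_regPart_succ.1 hx
      obtain ⟨w, hw, z, hz, rfl⟩ := ih v hv
      refine ⟨_, mem_regPart_succ.2 ⟨y, w, hw, rfl⟩, z, hz, ?_⟩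
      rw [map_add, pow_succ_apply', add_assoc]
  intro x hx
  obtain ⟨v, hv, z, hz, rfl⟩ := key d x hx
  rwa [hz, add_zero]

lemma disjoint (h : KatoData T d p e) : Disjoint (regPart T e d) (nilPart T d p) := by
  rw [Submodule.disjoint_def]
  intro x hx hx'
  rw [mem_nilPart] at hx'
  obtain ⟨y, hy⟩ := h.exists_pow_eq hx hx'.1
  -- If `T ^ (j + 1) x = 0`, then `T ^ j x ∈ N(T) ∩ R(T ^ d)` is fixed by `p`, yet `p` kills it.
  have key : ∀ j, (T ^ j) x = 0 → x = 0 := by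
    intro j
    induction j with
    | zero => exact id
    | succ j ih =>
      intro hj
      refine ih ?_
      rw [pow_succ_apply'] at hj
      rw [← hx'.2 j]
      exact (h.p_id _ hj ⟨(T ^ j) y, by
        change (T ^ d) ((T ^ j) y) = _
        rw [← pow_add_apply, add_comm, pow_add_apply, hy]⟩).symm
  exact key d hx'.1

/-- Corrections from `R(T ^ d) ⊆ M` make the conditions `p T ^ i x = 0` hold one at a time, from `i
= d - 1` down to `0`. -/
lemma nullSpace_pow_le_sup (h : KatoData T d p e) :
    nullSpace (T ^ d) ≤ regPart T e d ⊔ nilPart T d p := by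
  intro x hx
  rw [mem_nullSpace] at hx
  have key : ∀ k ≤ d, ∃ u ∈ rangeSpace (T ^ d), (T ^ d) u = 0 ∧
      ∀ i, d - k ≤ i → p ((T ^ i) (x - u)) = 0 := by
    intro k
    induction k with
    | zero =>
      refine fun _ => ⟨0, zero_mem _, map_zero _, fun i hi => ?_⟩
      rw [sub_zero, pow_apply_eq_zero_of_le (by omega) hx, map_zero]
    | succ k ih =>
      intro hk
      obtain ⟨u, hu, hu0, hui⟩ := ih (by omega)
      obtain ⟨j, hj⟩ : ∃ j, j = d - (k + 1) := ⟨_, rfl⟩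
      -- The exponent `j + d` makes the correction `T ^ d w` lie in `R(T ^ d)`; `T ^ (j + 1)` kills
      -- it, so the conditions already secured for larger `i` survive.
      obtain ⟨w, hw⟩ := h.le _ (h.p_ker ((T ^ j) (x - u))) (h.p_range _) (j + d)
      have hw : (T ^ j) ((T ^ d) w) = p ((T ^ j) (x - u)) := by
        rw [← pow_add_apply]; exact hw
      have h0 : ∀ i, j + 1 ≤ i → (T ^ i) ((T ^ d) w) = 0 := fun i hi =>
        pow_apply_eq_zero_of_le hi (by rw [pow_succ_apply', hw, h.p_ker])
      refine ⟨u + (T ^ d) w, add_mem hu ⟨w, rfl⟩, ?_, fun i hi => ?_⟩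
      · rw [map_add, hu0, h0 d (by omega), add_zero]
      · rw [← sub_sub, map_sub, map_sub]
        rcases (show i = j ∨ j + 1 ≤ i by omega) with rfl | hi'
        · rw [hw, h.p_id _ (h.p_ker _) (h.p_range _), sub_self]
        · rw [h0 i hi', hui i (by omega), map_zero, sub_self]
  obtain ⟨u, ⟨w, hw⟩, hu0, hui⟩ := key d le_rfl
  refine Submodule.mem_sup.2 ⟨u, ?_, x - u, mem_nilPart.2 ⟨?_, fun i => hui i (by omega)⟩, by abel⟩
  · rw [← hw]; exact pow_apply_mem_regPart T e d w
  · rw [map_sub, hx, hu0, sub_zero]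

/-- The Kato decomposition. -/
theorem red [CompleteSpace X] (h : KatoData T d p e) :
    Red T (regPart T e d) (nilPart T d p) := by
  have hc : IsCompl (regPart T e d) (nilPart T d p) := by
    refine ⟨h.disjoint, codisjoint_iff.2 (top_unique ?_)⟩
    rw [← h.regPart_sup d]
    exact sup_le le_sup_left h.nullSpace_pow_le_sup
  refine ⟨?_, isClosed_nilPart T d p, hc, fun x => map_mem_regPart, fun x => map_mem_nilPart⟩
  obtain ⟨n, S, hS⟩ := exists_regPart_eq_range T e d
  rw [hS] at hc ⊢
  exact isClosed_range_of_isCompl S (isClosed_nilPart T d p) hc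

/-- On `M`, `1 - e` projects onto the range of `T_M`, and `p` onto its null-space, because `N(T) ∩ M
= N(T) ∩ R(T ^ d)`. -/
theorem isSaphar_restrict (h : KatoData T d p e)
    (hM : ∀ x ∈ regPart T e d, T x ∈ regPart T e d) : IsSaphar (T.restrict hM) := by
  have hrange : IsComplemented (rangeSpace (T.restrict hM)) := by
    refine IsProjOnto.isComplemented (f := 1 - e.restrict fun x _ => apply_mem_regPart T e d x)
      ⟨fun x => ?_, ?_⟩
    · obtain ⟨y, v, hv, hx⟩ := mem_regPart_succ.1 (h.regPart_le_succ x.2)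
      refine ⟨⟨v, hv⟩, Subtype.ext ?_⟩
      change T v = x - e x
      rw [← hx, map_add, h.e_comp, h.e_idem, add_zero, add_sub_cancel_left]
    · rintro _ ⟨y, rfl⟩
      apply Subtype.ext
      change T y - e (T y) = T y
      rw [h.e_comp, sub_zero]
  refine ⟨⟨hrange.1, fun n _ x hx => ?_⟩, ?_, hrange⟩
  · have hx0 : T x = 0 := congrArg Subtype.val hx
    obtain ⟨y, hy⟩ := h.exists_pow_eq (n := 1) x.2 (by simpa using hx0)
    -- The extra `d` places the preimage `T ^ d w` in `M`.
    obtain ⟨w, hw⟩ := h.le x hx0 ⟨y, hy⟩ (n + d)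
    have hw : (T ^ n) ((T ^ d) w) = x := by rw [← pow_add_apply]; exact hw
    exact ⟨⟨_, pow_apply_mem_regPart T e d w⟩,
      Subtype.ext ((coe_restrict_pow_apply hM n _).trans hw)⟩
  · refine IsProjOnto.isComplemented (f := p.restrict fun x _ => ?_)
      ⟨fun x => Subtype.ext (h.p_ker x), fun x hx => Subtype.ext ?_⟩
    · obtain ⟨w, hw⟩ := h.p_range x
      rw [← hw]; exact pow_apply_mem_regPart T e d w
    · have hx0 : T x = 0 := congrArg Subtype.val hx
      obtain ⟨y, hy⟩ := h.exists_pow_eq (n := 1) x.2 (by simpa using hx0)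
      exact h.p_id x hx0 ⟨y, hy⟩

lemma restrict_nilPart_pow
    (hN : ∀ x ∈ nilPart T d p, T x ∈ nilPart T d p) : (T.restrict hN) ^ d = 0 := by
  ext x
  rw [coe_restrict_pow_apply]
  exact (mem_nilPart.1 x.2).1

theorem isOfSapharType [CompleteSpace X] (h : KatoData T d p e) : IsOfSapharType T := by
  have hne : {k : ℕ | (T.restrict h.red.invariant_right) ^ k = 0}.Nonempty :=
    ⟨d, restrict_nilPart_pow _⟩
  exact ⟨_, _, _, h.red, h.isSaphar_restrict _, Nat.sInf_mem hne, fun k hk => Nat.sInf_le hk⟩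

end KatoData

end SapharRiesz

/-! ### Compression by a commuting projector; Kato data of operators of Saphar type -/

namespace SapharRiesz

variable {X : Type*} [NormedAddCommGroup X] [NormedSpace ℂ X]

lemma mul_idem_pow_apply {T Q : X →L[ℂ] X} (hQ : IsIdempotentElem Q) (hc : Commute T Q) {n : ℕ}
    (hn : 1 ≤ n) (x : X) : ((T * Q) ^ n) x = (T ^ n) (Q x) := by
  rw [hc.mul_pow, hQ.pow_eq (by omega)]; rfl

namespace KatoData

variable {T : X →L[ℂ] X} {d : ℕ} {p e Q : X →L[ℂ] X}

/-- Kato data of a direct summand of an operator, extended by zero. -/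
theorem compress (h : KatoData T d p e) (hd : 1 ≤ d) (hQ : IsIdempotentElem Q)
    (hc : Commute T Q) : KatoData (T * Q) d (Q * p * Q) (Q * e * Q) := by
  have hQQ : ∀ x, Q (Q x) = Q x := fun x => DFunLike.congr_fun hQ x
  have hTQ : ∀ x, T (Q x) = Q (T x) := fun x => DFunLike.congr_fun hc x
  have hTQn : ∀ n x, (T ^ n) (Q x) = Q ((T ^ n) x) := fun n x =>
    DFunLike.congr_fun (hc.pow_left n) x
  have hpow : ∀ x, ((T * Q) ^ d) x = (T ^ d) (Q x) := mul_idem_pow_apply hQ hc hd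
  have aux : ∀ x, T (Q x) = 0 → x ∈ rangeSpace ((T * Q) ^ d) →
      Q x = x ∧ T x = 0 ∧ x ∈ rangeSpace (T ^ d) := by
    rintro x hx ⟨y, hy⟩
    have hy : (T ^ d) (Q y) = x := by rw [← hpow]; exact hy
    have hQx : Q x = x := by rw [← hy, hTQn, hQQ]
    exact ⟨hQx, by rwa [hQx] at hx, Q y, hy⟩
  constructor
  · intro x hx hxd n
    obtain ⟨h1, h2, h3⟩ := aux x hx hxd
    rcases Nat.eq_zero_or_pos n with rfl | hn
    · exact ⟨x, rfl⟩
    · obtain ⟨w, hw⟩ := h.le x h2 h3 n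
      have hw : (T ^ n) w = x := hw
      refine ⟨w, (mul_idem_pow_apply hQ hc hn w).trans ?_⟩
      rw [hTQn, hw, h1]
  · intro x
    change T (Q (Q (p (Q x)))) = 0
    rw [hTQ, hTQ, h.p_ker, map_zero, map_zero]
  · intro x
    obtain ⟨w, hw⟩ := h.p_range (Q x)
    have hw : (T ^ d) w = p (Q x) := hw
    refine ⟨w, (hpow w).trans ?_⟩
    rw [hTQn, hw]; rfl
  · intro x hx hxd
    obtain ⟨h1, h2, h3⟩ := aux x hx hxd
    change Q (p (Q x)) = x
    rw [h1, h.p_id x h2 h3, h1]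
  · intro x
    change Q (e (Q (T (Q x)))) = 0
    rw [← hTQ, h.e_comp, map_zero]
  · intro x hx
    change Q (e (Q x)) = 0
    rw [hpow] at hx
    rw [h.e_ker _ hx, map_zero]
  · intro x
    obtain ⟨y, z, hz, hx⟩ := h.e_sub (Q x)
    -- The part `x - Q x` is killed by `(T * Q) ^ d` only because `d ≥ 1`.
    refine ⟨y, Q z + (x - Q x), ?_, ?_⟩
    · rw [hpow, map_add, map_sub, hQQ, hQQ, sub_self, add_zero, hTQn, hz, map_zero]
    · have h1 := congrArg Q hx
      rw [hQQ, map_add, map_add, ← hTQ] at h1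
      change x = Q (e (Q x)) + T (Q y) + (Q z + (x - Q x))
      generalize Q (e (Q x)) = a, T (Q y) = b at h1 ⊢
      rw [h1]
      abel

end KatoData

lemma apply_eq_of_mem_regPart_compress {T Q e : X →L[ℂ] X} {d : ℕ} (hd : 1 ≤ d)
    (hQ : IsIdempotentElem Q) (hc : Commute T Q) {x : X}
    (hx : x ∈ regPart (T * Q) (Q * e * Q) d) : Q x = x := by
  have hQQ : ∀ x, Q (Q x) = Q x := fun x => DFunLike.congr_fun hQ x
  have hTQ : ∀ x, T (Q x) = Q (T x) := fun x => DFunLike.congr_fun hc x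
  obtain ⟨k, rfl⟩ := Nat.exists_eq_add_of_le' hd
  obtain ⟨y, v, -, rfl⟩ := mem_regPart_succ.1 hx
  change Q (Q (e (Q y)) + T (Q v)) = Q (e (Q y)) + T (Q v)
  rw [map_add, hTQ, hQQ, hQQ]

lemma mem_nilPart_compress {T Q p : X →L[ℂ] X} {d : ℕ} (hd : 1 ≤ d) {x : X}
    (hx : Q x = 0) : x ∈ nilPart (T * Q) d (Q * p * Q) := by
  have h1 : ∀ n, 1 ≤ n → ((T * Q) ^ n) x = 0 := fun n hn =>
    pow_apply_eq_zero_of_le hn (by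
      rw [pow_one]
      change T (Q x) = 0
      rw [hx, map_zero])
  refine mem_nilPart.2 ⟨h1 d hd, fun i => ?_⟩
  rcases Nat.eq_zero_or_pos i with rfl | hi
  · change Q (p (Q x)) = 0
    rw [hx, map_zero, map_zero]
  · rw [h1 i hi, map_zero]

theorem IsOfSapharType.exists_katoData [CompleteSpace X] {T : X →L[ℂ] X} (h : IsOfSapharType T) :
    ∃ d, 1 ≤ d ∧ ∃ p e, KatoData T d p e := by
  obtain ⟨k, M, N, hr, ⟨⟨-, hK⟩, hnull, hrange⟩, hk, -⟩ := h
  have := hr.isClosed_left.completeSpace_coe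
  obtain ⟨f, g, hf, hg, hf', hg', hfg⟩ := hr.exists_proj
  obtain ⟨π, hπ⟩ := hnull.exists_proj
  obtain ⟨ρ, hρ⟩ := hrange.exists_proj
  set S := T.restrict hr.invariant_left with hS
  have hN : ∀ y : N, (T ^ (k + 1)) (y : X) = 0 := fun y => by
    refine pow_apply_eq_zero_of_le (Nat.le_succ k) ?_
    rw [← coe_restrict_pow_apply hr.invariant_right, show (T.restrict hr.invariant_right) ^ k = 0
      from hk]
    rfl
  have hSn : ∀ n (m : M), (T ^ n) (m : X) = ((S ^ n) m : M) := fun n m =>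
    (coe_restrict_pow_apply hr.invariant_left n m).symm
  have hST : ∀ m : M, T (m : X) = (S m : M) := fun m => rfl
  have hTk : ∀ x, (T ^ (k + 1)) x = ((S ^ (k + 1)) (f x) : M) := fun x => by
    conv_lhs => rw [← hfg x, map_add, hN, add_zero, hSn]
  have hSf : ∀ x, f (T x) = S (f x) := fun x => by
    conv_lhs => rw [← hfg x, map_add, map_add, hST, hf]
    rw [hf' ⟨T (g x), hr.invariant_right _ (g x).2⟩, add_zero]
  have hker : ∀ m : M, S m = 0 → ∀ n, ∃ w : M, (T ^ n) (w : X) = m := by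
    intro m hm n
    rcases Nat.eq_zero_or_pos n with rfl | hn
    · exact ⟨m, rfl⟩
    · obtain ⟨w, hw⟩ := hK n hn hm
      exact ⟨w, (hSn n w).trans (congrArg Subtype.val hw)⟩
  have aux : ∀ x, T x = 0 → x ∈ rangeSpace (T ^ (k + 1)) → (f x : X) = x ∧ S (f x) = 0 := by
    rintro x hx ⟨y, hy⟩
    have hy : (((S ^ (k + 1)) (f y) : M) : X) = x := by rw [← hTk]; exact hy
    refine ⟨by rw [← hy, hf], ?_⟩
    rw [← hSf, hx, map_zero]
  -- The exponent `k + 1` instead of `k` guarantees `1 ≤ d`, as compression requires.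
  refine ⟨k + 1, by omega, M.subtypeL ∘L π ∘L f, M.subtypeL ∘L (1 - ρ) ∘L f, ?_⟩
  constructor
  · intro x hx hxd n
    obtain ⟨h1, h2⟩ := aux x hx hxd
    obtain ⟨w, hw⟩ := hker _ h2 n
    exact ⟨w, hw.trans h1⟩
  · intro x
    exact congrArg Subtype.val (hπ.mem (f x))
  · intro x
    obtain ⟨w, hw⟩ := hker _ (hπ.mem (f x)) (k + 1)
    exact ⟨w, hw⟩
  · intro x hx hxd
    obtain ⟨h1, h2⟩ := aux x hx hxd
    change ((π (f x) : M) : X) = x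
    rw [hπ.eq_self _ h2, h1]
  · intro x
    change ((f (T x) - ρ (f (T x)) : M) : X) = 0
    rw [hρ.eq_self _ ⟨f x, (hSf x).symm⟩, sub_self]; rfl
  · intro x hx
    have h1 : f x ∈ rangeSpace S := by
      -- For the Saphar operator `S` the exponent `0` is admissible, so `N(S ^ n) ⊆ R(S)` for every
      -- `n`.
      have h2 := nullSpace_pow_le (T := S) (d := 0) (fun x hx _ n => ?_) (k + 1)
        (show f x ∈ nullSpace (S ^ (k + 1)) from Subtype.ext ((hTk x).symm.trans hx))
      · rwa [show nullSpace (S ^ 0) = ⊥ from LinearMap.ker_id, sup_bot_eq] at h2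
      · rcases Nat.eq_zero_or_pos n with rfl | hn
        · exact ⟨x, rfl⟩
        · exact hK n hn hx
    change ((f x - ρ (f x) : M) : X) = 0
    rw [hρ.eq_self _ h1, sub_self]; rfl
  · intro x
    obtain ⟨m, hm⟩ := hρ.mem (f x)
    have hm : T (m : X) = (ρ (f x) : M) := congrArg Subtype.val hm
    refine ⟨m, g x, hN _, ?_⟩
    change x = ((f x : X) - ρ (f x)) + T m + g x
    rw [hm, sub_add_cancel, hfg]

/-! ### Kato data of essentially Saphar operators -/

section EssentiallySaphar

/-- The quotient map by `R` is injective on `G` and sends it into the image of `F`. -/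
lemma finiteDimensional_of_le_sup {V : Type*} [AddCommGroup V] [Module ℂ V]
    {G R F : Submodule ℂ V} [FiniteDimensional ℂ F] (h : G ≤ R ⊔ F) (hd : Disjoint G R) :
    FiniteDimensional ℂ G := by
  have hle : G.map R.mkQ ≤ F.map R.mkQ := by
    refine (Submodule.map_mono h).trans ?_
    rw [Submodule.map_sup]
    simp
  have : FiniteDimensional ℂ (G.map R.mkQ) := Submodule.finiteDimensional_of_le hle
  have hinj : Function.Injective (R.mkQ.domRestrict G) := by
    rw [← LinearMap.ker_eq_bot, LinearMap.ker_eq_bot']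
    intro x hx
    have hx : (x : V) ∈ R := by simpa using hx
    exact Subtype.ext (Submodule.disjoint_def.1 hd _ x.2 hx)
  exact FiniteDimensional.of_injective
    ((R.mkQ.domRestrict G).codRestrict (G.map R.mkQ) fun x => ⟨x, x.2, rfl⟩)
    (fun x y hxy => hinj (congrArg Subtype.val hxy))

lemma exists_finiteDimensional_map_ge {V W : Type*} [AddCommGroup V] [Module ℂ V]
    [AddCommGroup W] [Module ℂ W] (f : V →ₗ[ℂ] W) (G : Submodule ℂ W) [FiniteDimensional ℂ G] :
    ∃ F : Submodule ℂ V, FiniteDimensional ℂ F ∧ G ⊓ LinearMap.range f ≤ F.map f := by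
  obtain ⟨s, hs⟩ := f.rangeRestrict.exists_rightInverse_of_surjective f.range_rangeRestrict
  have hfin : FiniteDimensional ℂ (G.comap (LinearMap.range f).subtype) :=
    FiniteDimensional.of_injective
      (((LinearMap.range f).subtype ∘ₗ (G.comap (LinearMap.range f).subtype).subtype).codRestrict G
        fun x => x.2)
      fun x y hxy => Subtype.ext (Subtype.ext (congrArg (fun z : G => (z : W)) hxy))
  refine ⟨(G.comap (LinearMap.range f).subtype).map s, inferInstance, ?_⟩
  rintro x ⟨hxG, hxf⟩
  refine ⟨s ⟨x, hxf⟩, ⟨⟨x, hxf⟩, hxG, rfl⟩, ?_⟩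
  exact congrArg Subtype.val (LinearMap.congr_fun hs ⟨x, hxf⟩)

lemma exists_complement_in {V : Type*} [AddCommGroup V] [Module ℂ V] (N R : Submodule ℂ V) :
    ∃ G ≤ N, Disjoint G R ∧ N = (N ⊓ R) ⊔ G := by
  obtain ⟨G', hG'⟩ := (N ⊓ R).exists_isCompl
  refine ⟨N ⊓ G', inf_le_left, ?_, ?_⟩
  · rw [Submodule.disjoint_def]
    exact fun x hx hxR => Submodule.disjoint_def.1 hG'.disjoint x ⟨hx.1, hxR⟩ hx.2
  · rw [inf_comm N G', ← sup_inf_assoc_of_le _ inf_le_left, hG'.sup_eq_top, top_inf_eq]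

lemma rangeSpace_pow_antitone (T : X →L[ℂ] X) : Antitone fun n => rangeSpace (T ^ n) := by
  intro m n hmn
  obtain ⟨k, rfl⟩ := Nat.exists_eq_add_of_le hmn
  rintro _ ⟨y, rfl⟩
  exact ⟨(T ^ k) y, (pow_add_apply T m k y).symm⟩

lemma mem_iInf_rangeSpace_pow {T : X →L[ℂ] X} {x : X} :
    x ∈ (⨅ n : ℕ, ⨅ _ : 1 ≤ n, rangeSpace (T ^ n)) ↔ ∀ n, x ∈ rangeSpace (T ^ n) := by
  simp only [Submodule.mem_iInf]
  refine ⟨fun h n => ?_, fun h n _ => h n⟩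
  rcases Nat.eq_zero_or_pos n with rfl | hn
  · exact ⟨x, rfl⟩
  · exact h n hn

theorem IsEssentiallySaphar.exists_katoData [CompleteSpace X] {T : X →L[ℂ] X}
    (h : IsEssentiallySaphar T) : ∃ d p e, KatoData T d p e := by
  obtain ⟨⟨F, hF, hle⟩, hnull, hrange⟩ := h
  obtain ⟨G, hGN, hGR, hG⟩ :=
    exists_complement_in (nullSpace T) (⨅ n : ℕ, ⨅ _ : 1 ≤ n, rangeSpace (T ^ n))
  have hGfin : FiniteDimensional ℂ G := finiteDimensional_of_le_sup (hGN.trans hle) hGR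
  -- the ranges of the powers of `T` meet `G` trivially from some point on
  obtain ⟨d, hd⟩ : ∃ d, ∀ x ∈ G, x ∈ rangeSpace (T ^ d) → x = 0 := by
    obtain ⟨d, hd⟩ := IsArtinian.monotone_stabilizes
      (⟨fun n => OrderDual.toDual ((rangeSpace (T ^ n)).comap G.subtype),
        fun m n hmn => Submodule.comap_mono (rangeSpace_pow_antitone T hmn)⟩ :
        ℕ →o (Submodule ℂ G)ᵒᵈ)
    refine ⟨d, fun x hx hxd => Submodule.disjoint_def.1 hGR x hx
      (mem_iInf_rangeSpace_pow.2 fun n => ?_)⟩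
    have h1 : (rangeSpace (T ^ d)).comap G.subtype =
        (rangeSpace (T ^ (max d n))).comap G.subtype := hd _ (le_max_left d n)
    have h2 : (⟨x, hx⟩ : G) ∈ (rangeSpace (T ^ (max d n))).comap G.subtype := h1 ▸ hxd
    exact rangeSpace_pow_antitone T (le_max_right d n) h2
  have hsplit : ∀ x, T x = 0 → ∃ z, T z = 0 ∧ (∀ n, z ∈ rangeSpace (T ^ n)) ∧ ∃ g ∈ G,
      z + g = x := by
    intro x hx
    have hx' : x ∈ nullSpace T := hx
    rw [hG] at hx'
    obtain ⟨z, hz, g, hg, rfl⟩ := Submodule.mem_sup.1 hx'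
    exact ⟨z, hz.1, mem_iInf_rangeSpace_pow.1 hz.2, g, hg, rfl⟩
  have hZ : ∀ x, T x = 0 → x ∈ rangeSpace (T ^ d) → ∀ n, x ∈ rangeSpace (T ^ n) := by
    intro x hx hxd n
    obtain ⟨z, -, hzn, g, hg, rfl⟩ := hsplit x hx
    have hgd : g ∈ rangeSpace (T ^ d) := by simpa using sub_mem hxd (hzn d)
    rw [hd g hg hgd, add_zero]
    exact hzn n
  -- the projection onto the intersection of null-space and range
  obtain ⟨p, hp⟩ : ∃ p, IsProjOnto p (nullSpace T ⊓ rangeSpace (T ^ d)) := by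
    obtain ⟨-, C, hCc, hC⟩ := hnull
    have hker : IsClosed (nullSpace (T ^ (d + 1)) : Set X) := (T ^ (d + 1)).isClosed_ker
    have := hker.completeSpace_coe
    -- The target intersection is the range of `T ^ d` on `N(T ^ (d + 1))`. A closed complement is
    -- `C ⊕ G`, so both closedness and the projection follow.
    let S := (T ^ d) ∘L (nullSpace (T ^ (d + 1))).subtypeL
    have hS : LinearMap.range (S : nullSpace (T ^ (d + 1)) →ₗ[ℂ] X) = nullSpace T ⊓ rangeSpace (T ^ d) := by
      ext x
      constructor
      · rintro ⟨y, rfl⟩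
        refine ⟨?_, y, rfl⟩
        exact (pow_succ_apply' T d y).symm.trans y.2
      · rintro ⟨hx, y, rfl⟩
        exact ⟨⟨y, (pow_succ_apply' T d y).trans hx⟩, rfl⟩
    have hcl : IsClosed ((C ⊔ G : Submodule ℂ X) : Set X) :=
      C.isClosed_sup_finiteDimensional G hCc
    have hcompl : IsCompl (LinearMap.range (S : nullSpace (T ^ (d + 1)) →ₗ[ℂ] X)) (C ⊔ G) := by
      rw [hS]
      refine ⟨?_, codisjoint_iff.2 (top_unique ?_)⟩
      · rw [Submodule.disjoint_def]
        rintro x ⟨hx1, hx2⟩ hx3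
        obtain ⟨c, hc, g, hg, rfl⟩ := Submodule.mem_sup.1 hx3
        have hcN : c ∈ nullSpace T := by simpa using sub_mem hx1 (hGN hg)
        have hc0 : c = 0 := Submodule.disjoint_def.1 hC.disjoint c hcN hc
        subst hc0
        rw [zero_add] at hx2 ⊢
        exact hd g hg hx2
      · rw [← hC.sup_eq_top]
        refine sup_le ?_ (le_sup_of_le_right le_sup_left)
        intro x hx
        obtain ⟨z, hz, hzn, g, hg, rfl⟩ := hsplit x hx
        exact add_mem (Submodule.mem_sup_left ⟨hz, hzn d⟩)
          (Submodule.mem_sup_right (Submodule.mem_sup_right hg))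
    rw [← hS]
    exact IsComplemented.exists_proj ⟨isClosed_range_of_isCompl S hcl hcompl, _, hcl, hcompl⟩
  -- the null-space of a power is essentially contained in the range
  have hess : ∀ n, ∃ F : Submodule ℂ X, FiniteDimensional ℂ F ∧
      nullSpace (T ^ n) ≤ rangeSpace T ⊔ F := by
    intro n
    induction n with
    | zero =>
      refine ⟨⊥, inferInstance, fun x hx => ?_⟩
      have hx0 : x = 0 := hx
      rw [hx0]; exact zero_mem _
    | succ n ih =>
      obtain ⟨F₁, hF₁, h₁⟩ := ih
      -- `F₂` lifts the `G`-component of `T ^ n x` through `T ^ n`; after removing it and `T y`, `x`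
      -- falls into `N(T ^ n)`.
      obtain ⟨F₂, hF₂, h₂⟩ := exists_finiteDimensional_map_ge ((T ^ n : X →L[ℂ] X) : X →ₗ[ℂ] X) G
      refine ⟨F₁ ⊔ F₂, inferInstance, fun x hx => ?_⟩
      obtain ⟨z, hz, hzn, g, hg, hzg⟩ := hsplit ((T ^ n) x)
        ((pow_succ_apply' T n x).symm.trans hx)
      obtain ⟨y, hy⟩ := hzn (n + 1)
      have hy : (T ^ n) (T y) = z := by rw [← pow_succ_apply]; exact hy
      have hg' : (T ^ n) (x - T y) = g := by rw [map_sub, hy, ← hzg, add_sub_cancel_left]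
      obtain ⟨v, hv, hvg⟩ := h₂ ⟨hg, _, hg'⟩
      have hvg : (T ^ n) v = g := hvg
      have hk : x - T y - v ∈ nullSpace (T ^ n) := by
        rw [mem_nullSpace, map_sub, hg', hvg, sub_self]
      obtain ⟨r, hr, w, hw, hrw⟩ := Submodule.mem_sup.1 (h₁ hk)
      have hx' : x = (r + T y) + (w + v) := by
        have : x = (x - T y - v) + T y + v := by abel
        rw [this, ← hrw]; abel
      rw [hx']
      exact Submodule.add_mem_sup (add_mem hr ⟨y, rfl⟩) (Submodule.add_mem_sup hw hv)
  obtain ⟨F₀, hF₀, h₀⟩ := hess d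
  obtain ⟨r, hr⟩ := hrange.exists_proj
  -- `R(T) + N(T ^ d) = R(T) ⊕ H` with `H` finite-dimensional. Taking `H` inside `N(r)` makes `(1 -
  -- q)(1 - r)` vanish on this sum.
  obtain ⟨H, hHW, hHR, hH⟩ := exists_complement_in
    ((rangeSpace T ⊔ nullSpace (T ^ d)) ⊓ nullSpace r) (rangeSpace T)
  have hHfin : FiniteDimensional ℂ H := finiteDimensional_of_le_sup
    ((hHW.trans inf_le_left).trans (sup_le le_sup_left h₀)) hHR
  have hHmem : ∀ x ∈ rangeSpace T ⊔ nullSpace (T ^ d), x - r x ∈ H := by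
    intro x hx
    have h1 : x - r x ∈ (rangeSpace T ⊔ nullSpace (T ^ d)) ⊓ nullSpace r :=
      ⟨sub_mem hx (Submodule.mem_sup_left (hr.mem x)), by
        change r (x - r x) = 0
        rw [map_sub, hr.eq_self _ (hr.mem x), sub_self]⟩
    rw [hH] at h1
    obtain ⟨a, ⟨⟨-, ha⟩, haR⟩, b, hb, hab⟩ := Submodule.mem_sup.1 h1
    have ha0 : a = 0 := (hr.eq_self a haR).symm.trans ha
    rw [← hab, ha0, zero_add]
    exact hb
  obtain ⟨q, hq⟩ := (isComplemented_of_finiteDimensional H).exists_proj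
  have he : ∀ x, ((1 - q) * (1 - r)) x = x - r x - q (x - r x) := fun x => rfl
  have he0 : ∀ x ∈ rangeSpace T ⊔ nullSpace (T ^ d), ((1 - q) * (1 - r)) x = 0 := fun x hx => by
    rw [he, hq.eq_self _ (hHmem x hx), sub_self]
  refine ⟨d, p, (1 - q) * (1 - r), hZ, fun x => (hp.mem x).1, fun x => (hp.mem x).2,
    fun x hx hxd => hp.eq_self x ⟨hx, hxd⟩, fun x => he0 _ (Submodule.mem_sup_left ⟨x, rfl⟩),
    fun x hx => he0 _ (Submodule.mem_sup_right hx), fun x => ?_⟩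
  have hW : r x + q (x - r x) ∈ rangeSpace T ⊔ nullSpace (T ^ d) :=
    add_mem (Submodule.mem_sup_left (hr.mem x)) (hHW (hq.mem _)).1
  obtain ⟨_, ⟨y, rfl⟩, z, hz, hyz⟩ := Submodule.mem_sup.1 hW
  refine ⟨y, z, hz, ?_⟩
  have hyz : T y + z = r x + q (x - r x) := hyz
  rw [add_assoc, hyz, he]
  abel

end EssentiallySaphar

end SapharRiesz

/-! ### Riesz operators and the outer implications -/

namespace SapharRiesz

variable {X : Type*} [NormedAddCommGroup X] [NormedSpace ℂ X]

lemma finiteDimensional_quotient_of_surjective {V W : Type*} [AddCommGroup V] [Module ℂ V]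
    [AddCommGroup W] [Module ℂ W] {R : Submodule ℂ V} {S : Submodule ℂ W}
    (hR : FiniteDimensional ℂ (V ⧸ R)) (f : V →ₗ[ℂ] W ⧸ S) (hf : R ≤ LinearMap.ker f)
    (hs : Function.Surjective f) : FiniteDimensional ℂ (W ⧸ S) := by
  refine FiniteDimensional.of_surjective (R.liftQ f hf) fun y => ?_
  obtain ⟨x, rfl⟩ := hs y
  exact ⟨R.mkQ x, rfl⟩

/-- A Riesz operator restricts to a Riesz operator on a reducing subspace. -/
theorem IsRiesz.restrict [CompleteSpace X] {C : X →L[ℂ] X} (hC : IsRiesz C) {M N : Submodule ℂ X}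
    (h : Red C M N) : IsRiesz (C.restrict h.invariant_right) := by
  obtain ⟨f, g, hf, hg, hf', hg', hfg⟩ := h.exists_proj
  have hgC : ∀ x, g (C x) = C.restrict h.invariant_right (g x) := fun x => by
    conv_lhs => rw [← hfg x, map_add, map_add]
    rw [hg' ⟨C (f x), h.invariant_left _ (f x).2⟩, zero_add]
    exact hg ⟨C (g x), h.invariant_right _ (g x).2⟩
  intro lam hlam
  obtain ⟨h1, h2⟩ := hC lam hlam
  constructor
  · refine FiniteDimensional.of_injective
      ((N.subtype ∘ₗ (nullSpace (C.restrict h.invariant_right - lam • 1)).subtype).codRestrict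
        (nullSpace (C - lam • (1 : X →L[ℂ] X))) fun x => congrArg Subtype.val x.2)
      fun x y hxy => Subtype.ext (Subtype.ext (congrArg
        (fun z : nullSpace (C - lam • (1 : X →L[ℂ] X)) => (z : X)) hxy))
  · refine finiteDimensional_quotient_of_surjective h2
      ((rangeSpace (C.restrict h.invariant_right - lam • 1)).mkQ ∘ₗ (g : X →ₗ[ℂ] N)) ?_
      ((Submodule.mkQ_surjective _).comp fun n => ⟨n, hg n⟩)
    rintro _ ⟨x, rfl⟩
    refine (Submodule.Quotient.mk_eq_zero _).2 ⟨g x, ?_⟩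
    change C.restrict h.invariant_right (g x) - lam • g x = g (C x - lam • x)
    rw [map_sub, map_smul, hgC]

/-- The extension by zero of a Riesz operator on a reducing subspace is Riesz. -/
theorem IsRiesz.of_restrict {C : X →L[ℂ] X} {M N : Submodule ℂ X} (h : Red C M N)
    (hM : ∀ x ∈ M, C x = 0) (hN : IsRiesz (C.restrict h.invariant_right)) : IsRiesz C := by
  have hsplit : ∀ x, ∃ m ∈ M, ∃ n ∈ N, m + n = x := fun x =>
    Submodule.mem_sup.1 (h.isCompl.sup_eq_top ▸ Submodule.mem_top)
  intro lam hlam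
  obtain ⟨h1, h2⟩ := hN lam hlam
  constructor
  · refine Submodule.finiteDimensional_of_le
      (S₂ := (nullSpace (C.restrict h.invariant_right - lam • 1)).map N.subtype) fun x hx => ?_
    have hx : C x = lam • x := sub_eq_zero.1 hx
    have hxN : x ∈ N := by
      obtain ⟨m, hm, n, hn, rfl⟩ := hsplit x
      rw [map_add, hM m hm, zero_add] at hx
      exact (N.smul_mem_iff hlam).1 (hx ▸ h.invariant_right n hn)
    exact ⟨⟨x, hxN⟩, Subtype.ext (sub_eq_zero.2 hx), rfl⟩
  · refine finiteDimensional_quotient_of_surjective h2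
      ((rangeSpace (C - lam • (1 : X →L[ℂ] X))).mkQ ∘ₗ N.subtype) ?_ ?_
    · rintro _ ⟨x, rfl⟩
      exact (Submodule.Quotient.mk_eq_zero _).2 ⟨x, rfl⟩
    · intro y
      obtain ⟨x, rfl⟩ := Submodule.mkQ_surjective _ y
      obtain ⟨m, hm, n, hn, rfl⟩ := hsplit x
      refine ⟨⟨n, hn⟩, (Submodule.Quotient.eq _).2 ⟨lam⁻¹ • m, ?_⟩⟩
      change C (lam⁻¹ • m) - lam • lam⁻¹ • m = n - (m + n)
      rw [map_smul, hM m hm, smul_zero, smul_inv_smul₀ hlam]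
      abel

/-- The sum of a nilpotent operator and a Riesz operator is Riesz if their product vanishes. -/
theorem IsRiesz.nilpotent_add {B C : X →L[ℂ] X} (hC : IsRiesz C) (hB : IsNilpotent B)
    (hBC : B * C = 0) : IsRiesz (B + C) := by
  intro lam hlam
  have hBC' : ∀ x, B (C x) = 0 := fun x => DFunLike.congr_fun hBC x
  obtain ⟨h1, h2⟩ := hC lam hlam
  have hU : IsUnit (B - lam • (1 : X →L[ℂ] X)) := by
    rw [sub_eq_add_neg]
    refine hB.isUnit_add_right_of_commute (IsUnit.neg ?_) ?_
    · exact (isUnit_iff_exists.2 ⟨lam⁻¹ • 1, by simp [hlam], by simp [hlam]⟩)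
    · exact ((Commute.one_right B).smul_right lam).neg_right
  obtain ⟨V, hUV, hVU⟩ := isUnit_iff_exists.1 hU
  -- As `B C = 0`, `(B - λ)(C - λ) = -λ (B + C - λ)` with `B - λ` invertible; both finiteness
  -- properties pass across this factorization.
  have key : ∀ x, (B - lam • (1 : X →L[ℂ] X)) ((C - lam • (1 : X →L[ℂ] X)) x) =
      -lam • ((B + C - lam • (1 : X →L[ℂ] X)) x) := fun x => by
    change B (C x - lam • x) - lam • (C x - lam • x) = -lam • (B x + C x - lam • x)
    rw [map_sub, map_smul, hBC']
    module
  constructor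
  · refine Submodule.finiteDimensional_of_le
      (S₂ := nullSpace (C - lam • (1 : X →L[ℂ] X))) fun x hx => ?_
    have h3 := key x
    rw [mem_nullSpace.1 hx, smul_zero] at h3
    have h4 := DFunLike.congr_fun hVU ((C - lam • (1 : X →L[ℂ] X)) x)
    exact h4.symm.trans ((congrArg V h3).trans (map_zero V))
  · refine finiteDimensional_quotient_of_surjective h2
      ((rangeSpace (B + C - lam • (1 : X →L[ℂ] X))).mkQ ∘ₗ
        ((B - lam • (1 : X →L[ℂ] X) : X →L[ℂ] X) : X →ₗ[ℂ] X)) ?_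
      ((Submodule.mkQ_surjective _).comp fun y => ⟨V y, DFunLike.congr_fun hUV y⟩)
    rintro _ ⟨x, rfl⟩
    refine (Submodule.Quotient.mk_eq_zero _).2 ⟨-lam • x, ?_⟩
    exact (map_smul (B + C - lam • (1 : X →L[ℂ] X)) (-lam) x).trans (key x).symm

theorem AdmitsGSRD.exists_isEssentiallySaphar [CompleteSpace X] {A : X →L[ℂ] X}
    (h : AdmitsGSRD A) : ∃ P : X →L[ℂ] X, IsIdempotentElem P ∧ Commute A P ∧
      IsEssentiallySaphar (A + P) ∧ IsRiesz (A * P) := by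
  obtain ⟨M, N, hr, ⟨⟨-, hK⟩, hnull, hrange⟩, hR⟩ := h
  have := hr.isClosed_left.completeSpace_coe
  have := hr.isClosed_right.completeSpace_coe
  obtain ⟨f, g, hf, hg, hf', hg', hfg⟩ := hr.exists_proj
  set S := A.restrict hr.invariant_left with hS
  set D := A.restrict hr.invariant_right with hD
  have hfA : ∀ x, f (A x) = S (f x) := fun x => by
    conv_lhs => rw [← hfg x, map_add, map_add]
    rw [hf' ⟨A (g x), hr.invariant_right _ (g x).2⟩, add_zero]
    exact hf ⟨A (f x), hr.invariant_left _ (f x).2⟩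
  have hgA : ∀ x, g (A x) = D (g x) := fun x => by
    conv_lhs => rw [← hfg x, map_add, map_add]
    rw [hg' ⟨A (f x), hr.invariant_left _ (f x).2⟩, zero_add]
    exact hg ⟨A (g x), hr.invariant_right _ (g x).2⟩
  let P : X →L[ℂ] X := N.subtypeL ∘L g
  have hP : ∀ x, P x = g x := fun x => rfl
  -- `E = D + I` is the part of `A + P` on `N`; the Riesz condition at `-1` gives it
  -- finite-dimensional null-space and finite-codimensional range.
  set E := D - (-1 : ℂ) • (1 : N →L[ℂ] N) with hE
  have hEx : ∀ n, E n = D n + n := fun n => by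
    change D n - (-1 : ℂ) • n = D n + n
    module
  obtain ⟨hE1, hE2⟩ := hR (-1) (by norm_num)
  have hfT : ∀ x, f ((A + P) x) = S (f x) := fun x => by
    change f (A x + g x) = _
    rw [map_add, hf', add_zero, hfA]
  have hgT : ∀ x, g ((A + P) x) = E (g x) := fun x => by
    change g (A x + g x) = _
    rw [map_add, hg, hgA, hEx]
  have hSn : ∀ n (m : M), ((A + P) ^ n) (m : X) = ((S ^ n) m : M) := fun n => by
    induction n with
    | zero => exact fun m => rfl
    | succ n ih =>
      intro m
      rw [pow_succ_apply, pow_succ_apply, ← ih]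
      change ((A + P) ^ n) (A m + g m) = _
      rw [hg']
      change ((A + P) ^ n) (A m + 0) = _
      rw [add_zero]
      rfl
  have hext : ∀ x y, f x = f y → g x = g y → x = y := fun x y h1 h2 => by
    rw [← hfg x, ← hfg y, h1, h2]
  have hnullT : ∀ x, x ∈ nullSpace (A + P) ↔ f x ∈ nullSpace S ∧ g x ∈ nullSpace E := fun x => by
    rw [mem_nullSpace, mem_nullSpace, mem_nullSpace, ← hfT, ← hgT]
    refine ⟨fun h => by simp [h], fun h => hext _ _ ?_ ?_⟩
    · rw [h.1, map_zero]
    · rw [h.2, map_zero]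
  have hrangeT : ∀ x, x ∈ rangeSpace (A + P) ↔ f x ∈ rangeSpace S ∧ g x ∈ rangeSpace E :=
    fun x => by
      constructor
      · rintro ⟨y, rfl⟩
        exact ⟨⟨f y, (hfT y).symm⟩, ⟨g y, (hgT y).symm⟩⟩
      · rintro ⟨⟨m, hm⟩, n, hn⟩
        refine ⟨m + n, hext _ _ ((hfT _).trans ?_) ((hgT _).trans ?_)⟩
        · rw [map_add, hf, hf', add_zero]; exact hm
        · rw [map_add, hg, hg', zero_add]; exact hn
  have hcompl : ∀ {K : Submodule ℂ X} {K₁ : Submodule ℂ M} {K₂ : Submodule ℂ N},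
      (∀ x, x ∈ K ↔ f x ∈ K₁ ∧ g x ∈ K₂) → IsComplemented K₁ → IsComplemented K₂ →
      IsComplemented K := by
    intro K K₁ K₂ hK h1 h2
    obtain ⟨π, hπ⟩ := h1.exists_proj
    obtain ⟨ρ, hρ⟩ := h2.exists_proj
    refine IsProjOnto.isComplemented (f := M.subtypeL ∘L π ∘L f + N.subtypeL ∘L ρ ∘L g)
      ⟨fun x => (hK _).2 ?_, fun x hx => ?_⟩
    · change f (π (f x) + ρ (g x)) ∈ K₁ ∧ g (π (f x) + ρ (g x)) ∈ K₂
      rw [map_add, map_add, hf, hg, hf', hg', add_zero, zero_add]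
      exact ⟨hπ.mem _, hρ.mem _⟩
    · change (π (f x) : X) + ρ (g x) = x
      rw [hπ.eq_self _ ((hK x).1 hx).1, hρ.eq_self _ ((hK x).1 hx).2, hfg]
  refine ⟨P, ?_, ?_, ⟨⟨(nullSpace E).map N.subtype, inferInstance, fun x hx => ?_⟩,
    hcompl hnullT hnull (isComplemented_of_finiteDimensional _),
    hcompl hrangeT hrange (isComplemented_range_of_finite_quotient E hE2)⟩, ?_⟩
  · ext x
    change ((g (g x) : N) : X) = g x
    rw [hg]
  · ext x
    change A (g x) = g (A x)
    rw [hgA]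
    rfl
  · obtain ⟨h1, h2⟩ := (hnullT x).1 hx
    rw [← hfg x]
    refine Submodule.add_mem_sup (mem_iInf_rangeSpace_pow.2 fun n => ?_) ⟨g x, h2, rfl⟩
    rcases Nat.eq_zero_or_pos n with rfl | hn
    · exact ⟨f x, rfl⟩
    · obtain ⟨m, hm⟩ := hK n hn h1
      exact ⟨m, (hSn n m).trans (congrArg Subtype.val hm)⟩
  · have hAPM : ∀ x ∈ M, (A * P) x = 0 := fun x hx => by
      change A (g x) = 0
      rw [hg' ⟨x, hx⟩]
      exact map_zero A
    have hAPN : ∀ x ∈ N, (A * P) x = A x := fun x hx => by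
      change A (g x) = A x
      rw [hg ⟨x, hx⟩]
    have hred : Red (A * P) M N :=
      ⟨hr.isClosed_left, hr.isClosed_right, hr.isCompl, fun x hx => by
        rw [hAPM x hx]; exact zero_mem _, fun x hx => by
        rw [hAPN x hx]; exact hr.invariant_right x hx⟩
    refine IsRiesz.of_restrict hred hAPM ?_
    have heq : (A * P).restrict hred.invariant_right = D := by
      ext x
      exact hAPN x x.2
    rwa [heq]

theorem admitsGSRD_of_isOfSapharType [CompleteSpace X] {A P : X →L[ℂ] X}
    (hP : IsIdempotentElem P) (hc : Commute A P) (hT : IsOfSapharType (A + P))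
    (hR : IsRiesz (A * P)) : AdmitsGSRD A := by
  obtain ⟨d, hd, p, e, hk⟩ := hT.exists_katoData
  have hQ : IsIdempotentElem (1 - P) := hP.one_sub
  have hcQ : Commute (A + P) (1 - P) :=
    (Commute.one_right _).sub_right (hc.add_left (Commute.refl P))
  have hk' := hk.compress hd hQ hcQ
  set B := (A + P) * (1 - P) with hB
  have hPP : ∀ x, P (P x) = P x := fun x => DFunLike.congr_fun hP x
  have hAP : ∀ x, A (P x) = P (A x) := fun x => DFunLike.congr_fun hc x
  have hBx : ∀ x, B x = A x - A (P x) := fun x => by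
    change A (x - P x) + P (x - P x) = _
    rw [map_sub, map_sub, hPP, sub_self, add_zero]
  have hPM : ∀ x ∈ regPart B ((1 - P) * e * (1 - P)) d, P x = 0 := fun x hx =>
    sub_eq_self.1 (apply_eq_of_mem_regPart_compress hd hQ hcQ hx)
  have hPN : ∀ x, P x ∈ nilPart B d ((1 - P) * p * (1 - P)) := fun x =>
    mem_nilPart_compress hd (show P x - P (P x) = 0 by rw [hPP, sub_self])
  have hAM : ∀ x ∈ regPart B ((1 - P) * e * (1 - P)) d, A x = B x := fun x hx => by
    rw [hBx, hPM x hx, map_zero, sub_zero]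
  have hred := hk'.red
  have hredA : Red A _ _ := ⟨hred.isClosed_left, hred.isClosed_right, hred.isCompl,
    fun x hx => by rw [hAM x hx]; exact hred.invariant_left x hx,
    fun x hx => by
      have h1 : A x = B x + P (A x) := by rw [hBx, ← hAP, sub_add_cancel]
      rw [h1]
      exact add_mem (hred.invariant_right x hx) (hPN _)⟩
  have hredC : Red (A * P) _ _ := ⟨hred.isClosed_left, hred.isClosed_right, hred.isCompl,
    fun x hx => by
      change A (P x) ∈ _
      rw [hPM x hx, map_zero]; exact zero_mem _,
    fun x _ => by
      change A (P x) ∈ _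
      rw [hAP]; exact hPN _⟩
  refine ⟨_, _, hredA, ?_, ?_⟩
  · have heq : A.restrict hredA.invariant_left = B.restrict hred.invariant_left := by
      ext x
      exact hAM x x.2
    rw [heq]
    exact hk'.isSaphar_restrict _
  · have heq : A.restrict hredA.invariant_right =
        B.restrict hred.invariant_right + (A * P).restrict hredC.invariant_right := by
      ext x
      change A x = B x + A (P x)
      rw [hBx, sub_add_cancel]
    rw [heq]
    -- The product vanishes because `B` kills `R(P)`, which contains the range of `A P`.
    refine (hR.restrict hredC).nilpotent_add ⟨d, KatoData.restrict_nilPart_pow _⟩ ?_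
    ext x
    change B (A (P x)) = 0
    rw [hBx, hAP, hPP, sub_self]

end SapharRiesz

theorem mainTheorem5 {X : Type*} [NormedAddCommGroup X] [NormedSpace ℂ X] [CompleteSpace X]
    (A : X →L[ℂ] X) :
    List.TFAE [
      SapharRiesz.AdmitsGSRD A,
      ∃ P : X →L[ℂ] X, IsIdempotentElem P ∧ Commute A P ∧
        SapharRiesz.IsEssentiallySaphar (A + P) ∧ SapharRiesz.IsRiesz (A * P),
      ∃ P : X →L[ℂ] X, IsIdempotentElem P ∧ Commute A P ∧
        SapharRiesz.IsOfSapharType (A + P) ∧ SapharRiesz.IsRiesz (A * P)] := by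
  tfae_have 1 → 2 := fun h => h.exists_isEssentiallySaphar
  tfae_have 2 → 3 := fun ⟨P, hP, hc, hS, hR⟩ =>
    let ⟨_, _, _, hk⟩ := hS.exists_katoData
    ⟨P, hP, hc, hk.isOfSapharType, hR⟩
  tfae_have 3 → 1 := fun ⟨P, hP, hc, hT, hR⟩ =>
    SapharRiesz.admitsGSRD_of_isOfSapharType hP hc hT hR
  tfae_finish
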